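/- Let $A$ be a finite set, put $\widetilde A=A\sqcup A^{-1}$, and let $F_A$ be the free group on $A$. Let $H\le F_A$ be finitely generated. Choose a finite set $X$ of reduced words over $\widetilde A$ that generates $H$. The flower automaton $\mathcal F(X)$ has a basepoint $q_0$ (its only initial and only final vertex) and, for every word $x=a_1\cdots a_k\in X$ with $a_i\in\widetilde A$, a closed path $q_0\xrightarrow{a_1}\bullet\xrightarrow{a_2}\cdots\xrightarrow{a_k}q_0$ together with the inverse edges (for each edge $(p,a,q)$ the edge $(q,a^{-1},p)$); all intermediate vertices are distinct. A Stallings folding takes two distinct edges $p\xrightarrow{a}q$ and $p\xrightarrow{a}r$ with $a\in\widetilde A$ and identifies them together with their inverse edges, so that $q$ and $r$ become one vertex. A Stallings automaton $\mathcal S(H)$ of $H$ is any deterministic automaton obtained from such an $\mathcal F(X)$ by a finite sequence of foldings. It is called complete if for every vertex $p$ and every $a\in\widetilde A$ there is an edge with origin $p$ and label $a$. For every finitely generated $H\le F_A$ and every Stallings automaton $\mathcal S(H)$ of $H$ (that is, for all choices of $X$ and of the foldings): (i) $H$ has finite index in $F_A$ if and only if $\mathcal S(H)$ is complete. (ii)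 If $H$ has finite index in $F_A$, then the number of vertices of $\mathcal S(H)$ is finite and equal to the index $[F_A:H]$. Moreover, for every subgroup $H\le F_A$ of finite index $n$: (iii) $H$ is a free group of rank $1+n(|A|-1)$, that is, $H$ has a basis, and every basis of $H$ is finite with exactly $1+n(|A|-1)$ elements. -/

import Mathlib

universe u

namespace Stallings

/-! An automaton with edge labels in `α` is an `NFA α Q` of Mathlib: `Q` is the set of vertices and
`q ∈ M.step p a` says that `(p, a, q)` is an edge.  The involutive alphabet `A ∪ A⁻¹` is `A × Bool`
as in Mathlib's `FreeGroup A`: `(a, true)` is the letter `a` and `(a, false)` its inverse. -/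

/-- An automaton is deterministic if it has one initial vertex and no two distinct edges with the
same origin and the same label. -/
def IsDeterministic {α Q : Type*} (M : NFA α Q) : Prop :=
  (∃ q, M.start = {q}) ∧ ∀ p a, (M.step p a).Subsingleton

/-- An automaton is complete if at every vertex there starts an edge with every label. -/
def IsComplete {α Q : Type*} (M : NFA α Q) : Prop :=
  ∀ p a, (M.step p a).Nonempty

section Flower

variable {A : Type u}

/-- The vertices of the flower automaton of a set `X` of words: the basepoint `none`, and for each
`x ∈ X` the inner vertices of its petal, one for each position `i` with `0 < i < |x|`. -/
abbrev FlowerVertex (X : Set (List (A × Bool))) : Type u :=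
  Option (Σ x : X, {i : Fin x.1.length // 0 < i.1})

/-- The vertex in the petal of `x` that is reached after reading the first `i` letters of `x`; it is
the basepoint at both ends of the petal. -/
def petalVertex {X : Set (List (A × Bool))} (x : X) (i : ℕ) : FlowerVertex X :=
  if h : 0 < i ∧ i < x.1.length then some ⟨x, ⟨⟨i, h.2⟩, h.1⟩⟩ else none

/-- The edges of the flower automaton: the edges of each petal and their inverses. -/
inductive FlowerEdge (X : Set (List (A × Bool))) :
    FlowerVertex X → A × Bool → FlowerVertex X → Prop
  | forward (x : X) (i : ℕ) (hi : i < x.1.length) :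
      FlowerEdge X (petalVertex x i) (x.1[i]) (petalVertex x (i + 1))
  | inverse (x : X) (i : ℕ) (hi : i < x.1.length) :
      FlowerEdge X (petalVertex x (i + 1)) ((x.1[i]).1, !(x.1[i]).2) (petalVertex x i)

/-- The flower automaton of `X`; its basepoint is the only initial and the only final vertex. -/
def flower (X : Set (List (A × Bool))) : NFA (A × Bool) (FlowerVertex X) where
  step p a := {q | FlowerEdge X p a q}
  start := {none}
  accept := {none}

end Flower

section Folding

variable {α : Type*}

/-- The equivalence relation that identifies the points `q` and `r` and nothing else. -/
def identify {Q : Type u} (q r : Q) : Setoid Q where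
  r x y := x = y ∨ ((x = q ∨ x = r) ∧ (y = q ∨ y = r))
  iseqv :=
    { refl := fun _ => Or.inl rfl
      symm := by
        rintro x y (h | ⟨h, h'⟩)
        · exact Or.inl h.symm
        · exact Or.inr ⟨h', h⟩
      trans := by
        rintro x y z (rfl | ⟨h, h'⟩) (rfl | ⟨k, k'⟩)
        · exact Or.inl rfl
        · exact Or.inr ⟨k, k'⟩
        · exact Or.inr ⟨h, h'⟩
        · exact Or.inr ⟨h, k'⟩ }

/-- The automaton that arises from `M` by identifying the vertices `q` and `r`: its edges, its
initial and its final vertices are the images of those of `M`. -/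
def identifyVertices {Q : Type u} (M : NFA α Q) (q r : Q) : NFA α (Quotient (identify q r)) where
  step p' a := {t' | ∃ p t, t ∈ M.step p a ∧ Quotient.mk _ p = p' ∧ Quotient.mk _ t = t'}
  start := Quotient.mk _ '' M.start
  accept := Quotient.mk _ '' M.accept

/-- `FoldsTo M N`: the automaton `N` arises from `M` by a finite sequence of Stallings foldings.
A folding takes two distinct edges `(p, a, q)` and `(p, a, r)` and identifies them, that is, it
identifies the vertices `q` and `r` (edges with the same ends and the same label are equal, so
the edges and their inverses are identified as well). -/
inductive FoldsTo {Q₀ : Type u} (M : NFA α Q₀) : {Q : Type u} → NFA α Q → Prop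
  | refl : FoldsTo M M
  | fold {Q : Type u} {N : NFA α Q} (p : Q) (a : α) (q r : Q) :
      FoldsTo M N → q ∈ N.step p a → r ∈ N.step p a → q ≠ r →
        FoldsTo M (identifyVertices N q r)

end Folding

/-- `S` is a Stallings automaton of the subgroup `H` of the free group on `A`: it is deterministic
and it is obtained by Stallings foldings from the flower automaton of some finite set `X` of reduced
words that generates `H`. -/
def IsStallingsAutomaton {A Q : Type u} (H : Subgroup (FreeGroup A)) (S : NFA (A × Bool) Q) :
    Prop :=
  ∃ X : Set (List (A × Bool)), X.Finite ∧ (∀ x ∈ X, FreeGroup.IsReduced x) ∧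
    Subgroup.closure (FreeGroup.mk '' X) = H ∧ FoldsTo (flower X) S ∧ IsDeterministic S

/-! Every finitely generated subgroup has a Stallings automaton. -/

theorem foldsTo_finite_start {α : Type*} {Q₀ Q : Type u} {M : NFA α Q₀} {N : NFA α Q}
    (h : FoldsTo M N) (hf : Finite Q₀) (hs : ∃ q, M.start = {q}) :
    Finite Q ∧ ∃ q, N.start = {q} := by
  induction h with
  | refl => exact ⟨hf, hs⟩
  | fold p a q r _ _ _ _ ih =>
    obtain ⟨h1, s, h2⟩ := ih
    exact ⟨inferInstance, Quotient.mk _ s, by simp [identifyVertices, h2]⟩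

theorem exists_foldsTo_isDeterministic {α : Type*} {Q₀ : Type u} (M : NFA α Q₀) [Finite Q₀]
    (hs : ∃ q, M.start = {q}) :
    ∃ (Q : Type u) (N : NFA α Q), FoldsTo M N ∧ IsDeterministic N := by
  suffices H : ∀ (n : ℕ) (Q : Type u) (N : NFA α Q), FoldsTo M N → Nat.card Q = n →
      ∃ (Q : Type u) (N : NFA α Q), FoldsTo M N ∧ IsDeterministic N from
    H _ Q₀ M FoldsTo.refl rfl
  intro n
  induction n using Nat.strong_induction_on with
  | _ n ih =>
    intro Q N hN hn
    obtain ⟨hfin, hst⟩ := foldsTo_finite_start hN inferInstance hs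
    by_cases hd : IsDeterministic N
    · exact ⟨Q, N, hN, hd⟩
    have hd' : ∃ p a q r, q ∈ N.step p a ∧ r ∈ N.step p a ∧ q ≠ r := by
      by_contra! hc
      exact hd ⟨hst, fun p a q hq r hr => hc p a q r hq hr⟩
    obtain ⟨p, a, q, r, hq, hr, hqr⟩ := hd'
    refine ih _ ?_ _ _ (FoldsTo.fold p a q r hN hq hr hqr) rfl
    have hsurj : Function.Surjective (Quotient.mk (identify q r)) := Quotient.mk_surjective
    rw [← hn]
    refine lt_of_le_of_ne (Nat.card_le_card_of_surjective _ hsurj) fun he => hqr ?_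
    have hb := (Nat.bijective_iff_surjective_and_card (Quotient.mk (identify q r))).2
      ⟨hsurj, he.symm⟩
    exact hb.1 (Quotient.sound (Or.inr ⟨Or.inl rfl, Or.inr rfl⟩))

theorem exists_isStallingsAutomaton {A : Type u} (H : Subgroup (FreeGroup A)) (hH : H.FG) :
    ∃ (Q : Type u) (S : NFA (A × Bool) Q), IsStallingsAutomaton H S := by
  classical
  obtain ⟨T, hT⟩ := hH
  have hX : (FreeGroup.toWord '' (T : Set (FreeGroup A))).Finite := T.finite_toSet.image _
  have : Finite (FreeGroup.toWord '' (T : Set (FreeGroup A))) := hX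
  obtain ⟨Q, S, h1, h2⟩ := exists_foldsTo_isDeterministic
    (flower (FreeGroup.toWord '' (T : Set (FreeGroup A)))) ⟨none, rfl⟩
  refine ⟨Q, S, _, hX, ?_, ?_, h1, h2⟩
  · rintro _ ⟨g, _, rfl⟩
    exact FreeGroup.isReduced_toWord
  · rw [← hT, Set.image_image]
    simp [FreeGroup.mk_toWord]

end Stallings

namespace Stallings

/-! Each vertex `p` of the flower is sent to the coset `w⁻¹H`, where `w` labels any path from the
basepoint to `p`. This map, connectedness, inverse edges and loops representing all of `H` survive
every folding (`recognizes_flower`, `Recognizes.identifyVertices`), so they hold in `S` for any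
choice of `X` and of the foldings. Determinism makes the coset map injective and completeness makes
it surjective; finite index forces completeness because powers of any element return to `H`. This
gives (i) and (ii).

The rank is a dimension count. For `Y = G ⧸ H`, with `G` free on `A` and index `n`, crossed
homomorphisms from `G` to `ℚ^Y` have dimension `n|A|`, being determined freely on generators. As in
Shapiro's lemma, restriction to `H` maps them onto `Hom(H, ℚ) = ℚ^ι` with the coboundaries as
kernel, of dimension `n - 1`. Hence `n|A| = |ι| + n - 1`. -/

/-- `ReadsTo M p w q`: the word `w` labels a path of `M` from `p` to `q`. -/
def ReadsTo {α Q : Type*} (M : NFA α Q) : Q → List α → Q → Prop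
  | p, [], q => p = q
  | p, a :: w, q => ∃ r ∈ M.step p a, ReadsTo M r w q

/-! ### Paths and determinism -/

section Paths

variable {α Q : Type*} {M : NFA α Q}

theorem readsTo_append {p q : Q} {v w : List α} :
    ReadsTo M p (v ++ w) q ↔ ∃ r, ReadsTo M p v r ∧ ReadsTo M r w q := by
  induction v generalizing p with
  | nil => simp [ReadsTo]
  | cons a v ih =>
    simp only [List.cons_append, ReadsTo, ih]
    exact ⟨fun ⟨s, hs, r, h1, h2⟩ => ⟨r, ⟨s, hs, h1⟩, h2⟩,
      fun ⟨r, ⟨s, hs, h1⟩, h2⟩ => ⟨s, hs, r, h1, h2⟩⟩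

theorem readsTo_singleton {p q : Q} {a : α} : ReadsTo M p [a] q ↔ q ∈ M.step p a := by
  simp [ReadsTo]

theorem ReadsTo.eq_of_isDeterministic (hM : IsDeterministic M) {p q r : Q} {w : List α}
    (h : ReadsTo M p w q) (h' : ReadsTo M p w r) : q = r := by
  induction w generalizing p with
  | nil => exact Eq.trans (Eq.symm h) h'
  | cons a w ih =>
    obtain ⟨s, hs, h⟩ := h
    obtain ⟨t, ht, h'⟩ := h'
    obtain rfl := hM.2 p a hs ht
    exact ih h h'

theorem exists_readsTo_of_isComplete (hM : IsComplete M) (p : Q) (w : List α) :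
    ∃ q, ReadsTo M p w q := by
  induction w generalizing p with
  | nil => exact ⟨p, rfl⟩
  | cons a w ih =>
    obtain ⟨r, hr⟩ := hM p a
    obtain ⟨q, hq⟩ := ih r
    exact ⟨q, r, hr, hq⟩

theorem ReadsTo.identifyVertices {Q : Type u} {M : NFA α Q} {p q : Q} {w : List α}
    (h : ReadsTo M p w q) (r s : Q) :
    ReadsTo (identifyVertices M r s) (Quotient.mk _ p) w (Quotient.mk _ q) := by
  induction w generalizing p with
  | nil => exact congrArg _ (show p = q from h)
  | cons a w ih =>
    obtain ⟨t, ht, h⟩ := h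
    exact ⟨_, ⟨p, t, ht, rfl, rfl⟩, ih h⟩

end Paths

/-! ### Inverse edges, coset maps and foldings -/

variable {A : Type u}

/-- Every edge of the automaton has an inverse edge. -/
def HasInverseEdges {Q : Type*} (M : NFA (A × Bool) Q) : Prop :=
  ∀ p a q, q ∈ M.step p a → p ∈ M.step q (a.1, !a.2)

/-- A morphism from the automaton `M` with basepoint `o` to the graph of left cosets of `H` in which
the letter `a` leads from `a • c` to `c`. -/
def IsCosetMap {Q : Type*} (M : NFA (A × Bool) Q) (o : Q) {H : Subgroup (FreeGroup A)}
    (f : Q → FreeGroup A ⧸ H) : Prop :=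
  f o = (1 : FreeGroup A) ∧ ∀ p a q, q ∈ M.step p a → f p = FreeGroup.mk [a] • f q

theorem IsCosetMap.eq_smul_of_readsTo {Q : Type*} {M : NFA (A × Bool) Q} {o : Q}
    {H : Subgroup (FreeGroup A)} {f : Q → FreeGroup A ⧸ H} (hf : IsCosetMap M o f) {p q : Q}
    {w : List (A × Bool)} (h : ReadsTo M p w q) : f p = FreeGroup.mk w • f q := by
  induction w generalizing p with
  | nil => rw [show p = q from h, ← FreeGroup.one_eq_mk, one_smul]
  | cons a w ih =>
    obtain ⟨r, hr, h⟩ := h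
    rw [hf.2 p a r hr, ih h, ← mul_smul, FreeGroup.mul_mk, List.singleton_append]

section InverseEdges

variable {Q : Type*} {M : NFA (A × Bool) Q}

theorem HasInverseEdges.readsTo_invRev (hM : HasInverseEdges M) {p q : Q}
    {w : List (A × Bool)} (h : ReadsTo M p w q) : ReadsTo M q (FreeGroup.invRev w) p := by
  induction w generalizing p with
  | nil => exact Eq.symm h
  | cons a w ih =>
    obtain ⟨r, hr, h⟩ := h
    rw [FreeGroup.invRev_cons, readsTo_append]
    exact ⟨r, ih h, readsTo_singleton.2 (hM _ _ _ hr)⟩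

/-- A subpath reading a letter and then its inverse returns to its origin: the inverse of its first
edge is the only possible second edge. -/
theorem ReadsTo.red (hd : IsDeterministic M) (hi : HasInverseEdges M) {p q : Q}
    {v w : List (A × Bool)} (hr : FreeGroup.Red v w) (h : ReadsTo M p v q) : ReadsTo M p w q := by
  induction hr with
  | refl => exact h
  | tail _ hs ih =>
    cases hs with
    | @not L₁ L₂ x b =>
      obtain ⟨m, h1, r, hr, s, hs, h2⟩ := readsTo_append.1 ih
      obtain rfl := hd.2 r (x, !b) hs (hi m (x, b) r hr)
      exact readsTo_append.2 ⟨s, h1, h2⟩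

theorem ReadsTo.toWord [DecidableEq A] (hd : IsDeterministic M) (hi : HasInverseEdges M) {p q : Q}
    {w : List (A × Bool)} (h : ReadsTo M p w q) : ReadsTo M p (FreeGroup.mk w).toWord q := by
  rw [FreeGroup.toWord_mk]
  exact h.red hd hi FreeGroup.reduce.red

/-- The elements of the free group that are represented by closed paths at `o`. -/
def loopSubgroup (hM : HasInverseEdges M) (o : Q) : Subgroup (FreeGroup A) where
  carrier := {g | ∃ w, FreeGroup.mk w = g ∧ ReadsTo M o w o}
  one_mem' := ⟨[], FreeGroup.one_eq_mk.symm, rfl⟩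
  mul_mem' := by
    rintro _ _ ⟨v, rfl, hv⟩ ⟨w, rfl, hw⟩
    exact ⟨v ++ w, FreeGroup.mul_mk.symm, readsTo_append.2 ⟨o, hv, hw⟩⟩
  inv_mem' := by
    rintro _ ⟨v, rfl, hv⟩
    exact ⟨_, FreeGroup.inv_mk.symm, hM.readsTo_invRev hv⟩

end InverseEdges

/-- The automaton `M` is connected with basepoint `o`, all its edges have inverses, and the closed
paths at `o` represent exactly the elements of `H`. -/
structure Recognizes {Q : Type*} (M : NFA (A × Bool) Q) (o : Q) (H : Subgroup (FreeGroup A)) :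
    Prop where
  hasInverseEdges : HasInverseEdges M
  connected : ∀ p, ∃ w, ReadsTo M o w p
  exists_loop : ∀ g ∈ H, ∃ w, FreeGroup.mk w = g ∧ ReadsTo M o w o
  exists_cosetMap : ∃ f : Q → FreeGroup A ⧸ H, IsCosetMap M o f

theorem Recognizes.identifyVertices {Q : Type u} {M : NFA (A × Bool) Q} {o : Q}
    {H : Subgroup (FreeGroup A)} (h : Recognizes M o H) {p q r : Q} {a : A × Bool}
    (hq : q ∈ M.step p a) (hr : r ∈ M.step p a) :
    Recognizes (identifyVertices M q r) (Quotient.mk _ o) H where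
  hasInverseEdges := by
    rintro _ b _ ⟨s, t, ht, rfl, rfl⟩
    exact ⟨t, s, h.hasInverseEdges _ _ _ ht, rfl, rfl⟩
  connected := by
    intro s
    induction s using Quotient.inductionOn with
    | _ s =>
      obtain ⟨w, hw⟩ := h.connected s
      exact ⟨w, hw.identifyVertices q r⟩
  exists_loop := by
    intro g hg
    obtain ⟨w, hw, h⟩ := h.exists_loop g hg
    exact ⟨w, hw, h.identifyVertices q r⟩
  exists_cosetMap := by
    obtain ⟨f, hf⟩ := h.exists_cosetMap
    -- Both cosets are `a⁻¹ • f p`, so `f` descends to the quotient.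
    have hqr : f q = f r := smul_left_cancel _ ((hf.2 p a q hq).symm.trans (hf.2 p a r hr))
    refine ⟨Quotient.lift f ?_, hf.1, ?_⟩
    · rintro x y (h | ⟨rfl | rfl, rfl | rfl⟩) <;> simp_all
    · rintro _ b _ ⟨s, t, ht, rfl, rfl⟩
      exact hf.2 s b t ht

/-! ### The flower automaton -/

section Flower

variable {X : Set (List (A × Bool))}

theorem petalVertex_zero (x : X) : petalVertex x 0 = none := by simp [petalVertex]

theorem petalVertex_length (x : X) : petalVertex x x.1.length = none := by simp [petalVertex]

theorem flower_readsTo_take (x : X) (i : ℕ) (hi : i ≤ x.1.length) :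
    ReadsTo (flower X) none (x.1.take i) (petalVertex x i) := by
  induction i with
  | zero => simp [ReadsTo, petalVertex_zero]
  | succ i ih =>
    rw [List.take_succ_eq_append_getElem (by omega), readsTo_append]
    exact ⟨_, ih (by omega), readsTo_singleton.2 (FlowerEdge.forward x i (by omega))⟩

theorem flower_readsTo_petal (x : X) : ReadsTo (flower X) none x.1 none := by
  simpa [petalVertex_length] using flower_readsTo_take x x.1.length le_rfl

theorem hasInverseEdges_flower : HasInverseEdges (flower X) := by
  rintro _ _ _ (⟨x, i, hi⟩ | ⟨x, i, hi⟩)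
  · exact FlowerEdge.inverse x i hi
  · rw [Bool.not_not]
    exact FlowerEdge.forward x i hi

theorem flower_connected (p : FlowerVertex X) : ∃ w, ReadsTo (flower X) none w p := by
  rcases p with _ | ⟨x, ⟨i, hi⟩, h0⟩
  · exact ⟨[], rfl⟩
  · refine ⟨x.1.take i, ?_⟩
    have h0' : 0 < i := h0
    simpa [petalVertex, h0', hi] using flower_readsTo_take x i hi.le

/-- The coset that is reached from the trivial coset along the petals. -/
def flowerCoset (H : Subgroup (FreeGroup A)) : FlowerVertex X → FreeGroup A ⧸ H
  | none => (1 : FreeGroup A)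
  | some ⟨x, i⟩ => ((FreeGroup.mk (x.1.take i.1.1))⁻¹ : FreeGroup A)

theorem flowerCoset_petalVertex {H : Subgroup (FreeGroup A)}
    (hX : Subgroup.closure (FreeGroup.mk '' X) = H) (x : X) (i : ℕ) (hi : i ≤ x.1.length) :
    flowerCoset H (petalVertex x i) = ((FreeGroup.mk (x.1.take i))⁻¹ : FreeGroup A) := by
  rcases Nat.eq_zero_or_pos i with rfl | h0
  · simp [petalVertex_zero, flowerCoset, ← FreeGroup.one_eq_mk]
  rcases hi.lt_or_eq with hi | rfl
  · simp [petalVertex, h0, hi, flowerCoset]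
  -- The petal closes up consistently at its end because `x` lies in `H`.
  · have hx : FreeGroup.mk x.1 ∈ H := hX ▸ Subgroup.subset_closure ⟨x.1, x.2, rfl⟩
    rw [petalVertex_length, List.take_length]
    exact QuotientGroup.eq.2 (by rwa [inv_one, one_mul, inv_mem_iff])

theorem recognizes_flower {H : Subgroup (FreeGroup A)}
    (hX : Subgroup.closure (FreeGroup.mk '' X) = H) : Recognizes (flower X) none H where
  hasInverseEdges := hasInverseEdges_flower
  connected := flower_connected
  exists_loop := by
    intro g hg
    suffices H ≤ loopSubgroup (M := flower X) hasInverseEdges_flower none from this hg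
    rw [← hX, Subgroup.closure_le]
    rintro _ ⟨x, hx, rfl⟩
    exact ⟨x, rfl, flower_readsTo_petal ⟨x, hx⟩⟩
  exists_cosetMap := by
    have key : ∀ (x : X) (i : ℕ) (hi : i < x.1.length),
        flowerCoset H (petalVertex x i) =
          FreeGroup.mk [x.1[i]] • flowerCoset H (petalVertex x (i + 1)) := by
      intro x i hi
      rw [flowerCoset_petalVertex hX x i hi.le, flowerCoset_petalVertex hX x (i + 1) hi,
        List.take_succ_eq_append_getElem hi, ← FreeGroup.mul_mk, MulAction.Quotient.smul_coe,
        smul_eq_mul, mul_inv_rev, mul_inv_cancel_left]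
    refine ⟨flowerCoset H, rfl, ?_⟩
    rintro _ _ _ (⟨x, i, hi⟩ | ⟨x, i, hi⟩)
    · exact key x i hi
    · rw [key x i hi, ← mul_smul, FreeGroup.mul_mk]
      have : (FreeGroup.mk ([((x.1[i]).1, !(x.1[i]).2)] ++ [x.1[i]]) : FreeGroup A) = 1 := by
        rw [← FreeGroup.mul_mk]
        have := FreeGroup.inv_mk (L := [x.1[i]])
        simp only [FreeGroup.invRev, List.map_cons, List.map_nil, List.reverse_singleton] at this
        rw [← this, inv_mul_cancel]
      rw [this, one_smul]

end Flower

theorem recognizes_of_foldsTo {X : Set (List (A × Bool))} {H : Subgroup (FreeGroup A)}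
    (hX : Subgroup.closure (FreeGroup.mk '' X) = H) {Q : Type u} {S : NFA (A × Bool) Q}
    (h : FoldsTo (flower X) S) : ∃ o, Recognizes S o H := by
  induction h with
  | refl => exact ⟨none, recognizes_flower hX⟩
  | fold p a q r _ hq hr _ ih =>
    obtain ⟨o, ho⟩ := ih
    exact ⟨_, ho.identifyVertices hq hr⟩

theorem finite_of_isStallingsAutomaton {H : Subgroup (FreeGroup A)} {Q : Type u}
    {S : NFA (A × Bool) Q} (h : IsStallingsAutomaton H S) : Finite Q := by
  obtain ⟨X, hX, -, -, hS, -⟩ := h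
  have := hX.to_subtype
  exact (foldsTo_finite_start hS inferInstance ⟨none, rfl⟩).1

theorem mk_singleton_pow_succ (a : A × Bool) (n : ℕ) :
    FreeGroup.mk [a] ^ (n + 1) = FreeGroup.mk (a :: List.replicate n a) := by
  induction n with
  | zero => simp
  | succ n ih => rw [pow_succ', ih]; simp [FreeGroup.mul_mk, List.replicate_succ]

/-! ### Vertices of a deterministic automaton as cosets -/

section Deterministic

variable {Q : Type*} {M : NFA (A × Bool) Q} {o : Q} {H : Subgroup (FreeGroup A)}

/-- If `v`, `w` lead to vertices with equal cosets, then `vw⁻¹ ∈ H` is represented by a loop `l`.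
The paths `lw` and `v` have the same reduced word, hence the same end. -/
theorem IsCosetMap.injective {f : Q → FreeGroup A ⧸ H} (hf : IsCosetMap M o f)
    (hM : Recognizes M o H) (hd : IsDeterministic M) : Function.Injective f := by
  classical
  intro p q hpq
  obtain ⟨v, hv⟩ := hM.connected p
  obtain ⟨w, hw⟩ := hM.connected q
  have h1 := hf.eq_smul_of_readsTo hv
  have h2 := hf.eq_smul_of_readsTo hw
  have h3 : FreeGroup.mk v * (FreeGroup.mk w)⁻¹ ∈ H := by
    rw [hf.1, eq_comm, ← eq_inv_smul_iff] at h1 h2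
    rw [h1, h2, MulAction.Quotient.smul_coe, MulAction.Quotient.smul_coe, QuotientGroup.eq] at hpq
    simpa using hpq
  obtain ⟨l, hl, hlo⟩ := hM.exists_loop _ h3
  have h4 := (readsTo_append.2 ⟨o, hlo, hw⟩).toWord hd hM.hasInverseEdges
  rw [← FreeGroup.mul_mk, hl, inv_mul_cancel_right] at h4
  exact (hv.toWord hd hM.hasInverseEdges).eq_of_isDeterministic hd h4

theorem IsCosetMap.surjective {f : Q → FreeGroup A ⧸ H} (hf : IsCosetMap M o f)
    (hc : IsComplete M) : Function.Surjective f := by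
  classical
  intro c
  induction c using QuotientGroup.induction_on with
  | _ g =>
    obtain ⟨q, hq⟩ := exists_readsTo_of_isComplete hc o g⁻¹.toWord
    refine ⟨q, ?_⟩
    have h := hf.eq_smul_of_readsTo hq
    rw [FreeGroup.mk_toWord, hf.1, eq_inv_smul_iff] at h
    rw [← h, MulAction.Quotient.smul_coe, smul_eq_mul, mul_one]

theorem Recognizes.isComplete (hM : Recognizes M o H) (hd : IsDeterministic M)
    (hH : H.FiniteIndex) : IsComplete M := by
  classical
  intro p a
  obtain ⟨v, hv⟩ := hM.connected p
  obtain ⟨u, hu, hur⟩ : ∃ u, ReadsTo M o u p ∧ FreeGroup.IsReduced u :=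
    ⟨_, hv.toWord hd hM.hasInverseEdges, FreeGroup.isReduced_toWord⟩
  by_cases hr : FreeGroup.IsReduced (u ++ [a])
  -- Some `(u a u⁻¹)ⁿ` with `n > 0` is in `H`. Its loop followed by `u` reduces to `u aⁿ`, which
  -- passes through `p` and then reads `a`.
  · obtain ⟨n, hn, -, hmem⟩ := Subgroup.exists_pow_mem_of_index_ne_zero hH.index_ne_zero
      (FreeGroup.mk u * FreeGroup.mk [a] * (FreeGroup.mk u)⁻¹)
    obtain ⟨m, rfl⟩ := Nat.exists_eq_succ_of_ne_zero hn.ne'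
    obtain ⟨l, hl, hlo⟩ := hM.exists_loop _ hmem
    have h1 := (readsTo_append.2 ⟨o, hlo, hu⟩).toWord hd hM.hasInverseEdges
    rw [← FreeGroup.mul_mk, hl, conj_pow, inv_mul_cancel_right, mk_singleton_pow_succ,
      FreeGroup.mul_mk,
      FreeGroup.toWord_mk, FreeGroup.IsReduced.reduce_eq] at h1
    · obtain ⟨p', hp', r, hr, -⟩ := readsTo_append.1 h1
      obtain rfl := hu.eq_of_isDeterministic hd hp'
      exact ⟨r, hr⟩
    · rw [← List.singleton_append, ← List.append_assoc]
      refine FreeGroup.IsReduced.append_overlap hr ?_ (by simp)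
      exact List.isChain_replicate_of_rel (m + 1) fun _ => rfl
  -- Here `u` ends in `a⁻¹`, so its last edge, reversed, leaves `p` with label `a`.
  · have hlast : ∃ x ∈ u.getLast?, x.1 = a.1 ∧ x.2 ≠ a.2 := by
      by_contra! hcon
      exact hr (List.isChain_append.2 ⟨hur, List.isChain_singleton a, by simpa using hcon⟩)
    obtain ⟨x, hx, h1, h2⟩ := hlast
    obtain ⟨v, rfl⟩ := List.mem_getLast?_eq_getLast hx |>.elim fun h e =>
      (⟨u.dropLast, by rw [e, List.dropLast_append_getLast]⟩ : ∃ v, u = v ++ [x])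
    obtain ⟨m, -, hm⟩ := readsTo_append.1 hu
    have := hM.hasInverseEdges _ _ _ (readsTo_singleton.1 hm)
    rw [h1, show (!x.2) = a.2 by revert h2; cases x.2 <;> cases a.2 <;> simp] at this
    exact ⟨m, this⟩

end Deterministic

theorem IsStallingsAutomaton.finiteIndex_iff_isComplete {H : Subgroup (FreeGroup A)} {Q : Type u}
    {S : NFA (A × Bool) Q} (h : IsStallingsAutomaton H S) :
    H.FiniteIndex ↔ IsComplete S := by
  have := finite_of_isStallingsAutomaton h
  obtain ⟨X, -, -, hX, hS, hd⟩ := h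
  obtain ⟨o, hM⟩ := recognizes_of_foldsTo hX hS
  obtain ⟨f, hf⟩ := hM.exists_cosetMap
  refine ⟨hM.isComplete hd, fun hc => ?_⟩
  have := Finite.of_surjective f (hf.surjective hc)
  exact Subgroup.finiteIndex_of_finite_quotient

theorem IsStallingsAutomaton.index_eq_card {H : Subgroup (FreeGroup A)} {Q : Type u}
    {S : NFA (A × Bool) Q} (h : IsStallingsAutomaton H S) (hH : H.FiniteIndex) :
    H.index = Nat.card Q := by
  obtain ⟨X, -, -, hX, hS, hd⟩ := h
  obtain ⟨o, hM⟩ := recognizes_of_foldsTo hX hS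
  obtain ⟨f, hf⟩ := hM.exists_cosetMap
  exact (Nat.card_congr (Equiv.ofBijective f
    ⟨hf.injective hM hd, hf.surjective (hM.isComplete hd hH)⟩)).symm

end Stallings

namespace Stallings

/-! ### Crossed homomorphisms and the rank formula -/

section Cocycles

variable {G : Type*} [Group G]

/-- The crossed homomorphisms from `G` to the rational functions on a `G`-set `Y`. -/
def cocycles (G Y : Type*) [Group G] [MulAction G Y] : Submodule ℚ (G → Y → ℚ) where
  carrier := {z | ∀ g h y, z (g * h) y = z g (h • y) + z h y}
  add_mem' := by
    intro z w hz hw g h y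
    simp only [Pi.add_apply, hz g h y, hw g h y]
    ring
  zero_mem' := by simp
  smul_mem' := by
    intro c z hz g h y
    simp only [Pi.smul_apply, hz g h y, smul_add]

/-- The restriction of a crossed homomorphism to free generators. -/
def cocyclesToGenerators (A Y : Type*) [MulAction (FreeGroup A) Y] :
    cocycles (FreeGroup A) Y →ₗ[ℚ] (A × Y → ℚ) where
  toFun z x := z.1 (FreeGroup.of x.1) x.2
  map_add' _ _ := rfl
  map_smul' _ _ := rfl

theorem cocycles_one {Y : Type*} [MulAction G Y] (z : cocycles G Y) (y : Y) : z.1 1 y = 0 := by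
  have := z.2 1 1 y
  rw [one_smul, mul_one] at this
  linarith

theorem cocycles_inv {Y : Type*} [MulAction G Y] (z : cocycles G Y) (g : G) (y : Y) :
    z.1 g⁻¹ y = - z.1 g (g⁻¹ • y) := by
  have := z.2 g g⁻¹ y
  rw [mul_inv_cancel, cocycles_one] at this
  linarith

/-- The permutation of `Y × ℚ` that moves `y` by `g` and shifts the fibre over `y` by `c y`. -/
def skewShift {Y : Type*} [MulAction G Y] (g : G) (c : Y → ℚ) : Equiv.Perm (Y × ℚ) where
  toFun x := (g • x.1, x.2 + c x.1)
  invFun x := (g⁻¹ • x.1, x.2 - c (g⁻¹ • x.1))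
  left_inv x := by simp
  right_inv x := by simp

theorem cocyclesToGenerators_injective (A Y : Type*) [MulAction (FreeGroup A) Y] :
    Function.Injective (cocyclesToGenerators A Y) := by
  rw [← LinearMap.ker_eq_bot, LinearMap.ker_eq_bot']
  intro z hz
  have hof : ∀ a y, z.1 (FreeGroup.of a) y = 0 := fun a y => congrFun hz (a, y)
  ext g y
  change z.1 g y = 0
  induction g using FreeGroup.induction_on generalizing y with
  | C1 => exact cocycles_one z y
  | of a => exact hof a y
  | inv_of a _ => rw [cocycles_inv, hof, neg_zero]
  | mul g h hg hh => rw [z.2, hg, hh, add_zero]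

/-- Prescribed values on generators define an action on `Y × ℚ` by freeness; the shift in the fibres
is the crossed homomorphism. -/
theorem cocyclesToGenerators_surjective (A Y : Type*) [MulAction (FreeGroup A) Y] :
    Function.Surjective (cocyclesToGenerators A Y) := by
  intro c
  let Φ : FreeGroup A →* Equiv.Perm (Y × ℚ) :=
    FreeGroup.lift fun a => skewShift (FreeGroup.of a) fun y => c (a, y)
  have hof : ∀ a x, Φ (FreeGroup.of a) x = (FreeGroup.of a • x.1, x.2 + c (a, x.1)) := by
    intro a x
    simp [Φ, skewShift]
  have hΦ : ∀ g y t, Φ g (y, t) = (g • y, t + (Φ g (y, 0)).2) := by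
    intro g
    induction g using FreeGroup.induction_on with
    | C1 => simp
    | of a => simp [hof]
    | inv_of a _ =>
      intro y t
      have h : ∀ s, Φ (FreeGroup.of a)⁻¹ (y, s) =
          ((FreeGroup.of a)⁻¹ • y, s - c (a, (FreeGroup.of a)⁻¹ • y)) := by
        intro s
        rw [map_inv, Equiv.Perm.inv_eq_iff_eq, hof]
        simp
      rw [h, h]
      simp [sub_eq_add_neg]
    | mul g h hg hh =>
      intro y t
      simp only [map_mul, Equiv.Perm.mul_apply]
      rw [hh y t, hh y 0, hg _ (t + _), hg _ (0 + _)]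
      simp [mul_smul, add_assoc]
  refine ⟨⟨fun g y => (Φ g (y, 0)).2, fun g h y => ?_⟩, ?_⟩
  · beta_reduce
    rw [map_mul, Equiv.Perm.mul_apply, hΦ h y 0, hΦ g]
    simp [add_comm]
  · ext ⟨a, y⟩
    simp [cocyclesToGenerators, hof]

/-- The crossed homomorphism `g ↦ φ (g • y) - φ y`. -/
def coboundary (G Y : Type*) [Group G] [MulAction G Y] : (Y → ℚ) →ₗ[ℚ] cocycles G Y where
  toFun φ := ⟨fun g y => φ (g • y) - φ y, fun g h y => by simp [mul_smul]⟩
  map_add' φ ψ := by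
    ext g y
    simp only [Pi.add_apply, Submodule.coe_add]
    ring
  map_smul' c φ := by
    ext g y
    simp [mul_sub]

theorem finrank_ker_coboundary (G Y : Type*) [Group G] [MulAction G Y]
    [MulAction.IsPretransitive G Y] [Nonempty Y] :
    Module.finrank ℚ (LinearMap.ker (coboundary G Y)) = 1 := by
  obtain ⟨y₀⟩ := ‹Nonempty Y›
  have hmem : (fun _ : Y => (1 : ℚ)) ∈ LinearMap.ker (coboundary G Y) := by
    ext g y
    simp [coboundary]
  refine finrank_eq_one ⟨_, hmem⟩ (fun h => ?_) fun φ => ⟨φ.1 y₀, ?_⟩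
  · exact one_ne_zero (congrFun (congrArg Subtype.val h) y₀)
  · ext y
    obtain ⟨g, rfl⟩ := MulAction.exists_smul_eq G y₀ y
    have h : φ.1 (g • y₀) - φ.1 y₀ = 0 :=
      congrFun (congrFun (congrArg Subtype.val (LinearMap.mem_ker.1 φ.2)) g) y₀
    simp
    linarith

variable {H : Subgroup G} {ι : Type*}

/-- A crossed homomorphism restricts to a homomorphism on the stabilizer of the trivial coset. -/
def cocycleRestrict (z : cocycles G (G ⧸ H)) : H →* Multiplicative ℚ where
  toFun h := .ofAdd (z.1 h (1 : G))
  map_one' := by simp [cocycles_one]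
  map_mul' g h := by
    have : (h : G) • ((1 : G) : G ⧸ H) = (1 : G) := by
      rw [MulAction.Quotient.smul_coe]
      exact QuotientGroup.eq.2 (by simp)
    rw [Subgroup.coe_mul, z.2, this, ofAdd_add]

/-- The values of a crossed homomorphism on a basis of `H`. -/
def cocyclesToBasis (b : FreeGroupBasis ι H) : cocycles G (G ⧸ H) →ₗ[ℚ] (ι → ℚ) where
  toFun z i := z.1 (b i) (1 : G)
  map_add' _ _ := rfl
  map_smul' _ _ := rfl

theorem cocyclesToBasis_surjective (b : FreeGroupBasis ι H) :
    Function.Surjective (cocyclesToBasis b) := by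
  intro c
  let χ : H →* Multiplicative ℚ := b.lift fun i => .ofAdd (c i)
  -- With a section `s`, the extension of `χ` is `χ (s(gq)⁻¹ g s(q))`.
  obtain ⟨s, hs⟩ : ∃ s : G ⧸ H → G, ∀ q, (s q : G ⧸ H) = q :=
    ⟨Quotient.out, fun q => QuotientGroup.out_eq' q⟩
  have hmem : ∀ g q, (s (g • q))⁻¹ * (g * s q) ∈ H := by
    intro g q
    rw [← QuotientGroup.eq, hs, ← smul_eq_mul, ← MulAction.Quotient.smul_coe, hs]
  refine ⟨⟨fun g q => (χ ⟨_, hmem g q⟩).toAdd, fun g h q => ?_⟩, ?_⟩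
  · beta_reduce
    rw [← toAdd_mul, ← map_mul]
    congr 2
    ext
    simp [mul_smul, mul_assoc]
  · ext i
    have h1 : s (1 : G) ∈ H := by
      simpa using QuotientGroup.eq.1 (hs (1 : G)).symm
    have h2 : (b i : G) • ((1 : G) : G ⧸ H) = (1 : G) := by
      rw [MulAction.Quotient.smul_coe]
      exact QuotientGroup.eq.2 (by simp)
    -- Conjugation by `s 1 ∈ H` is invisible to `χ`, whose target is abelian.
    have h3 : (⟨_, hmem (b i) (1 : G)⟩ : H) = ⟨_, h1⟩⁻¹ * (b i * ⟨_, h1⟩) := by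
      ext
      simp only [h2, Subgroup.coe_mul, Subgroup.coe_inv]
    change (χ ⟨_, hmem (b i) (1 : G)⟩).toAdd = c i
    rw [h3]
    simp [χ]

theorem range_coboundary_eq_ker (b : FreeGroupBasis ι H) :
    LinearMap.range (coboundary G (G ⧸ H)) = LinearMap.ker (cocyclesToBasis b) := by
  apply le_antisymm
  · rintro _ ⟨φ, rfl⟩
    ext i
    have h : (b i : G) • ((1 : G) : G ⧸ H) = (1 : G) := by
      rw [MulAction.Quotient.smul_coe]
      exact QuotientGroup.eq.2 (by simp)
    change φ ((b i : G) • ((1 : G) : G ⧸ H)) - φ (1 : G) = 0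
    rw [h, sub_self]
  · intro z hz
    have hone : cocycleRestrict z = 1 :=
      b.ext_hom _ _ fun i => congrArg Multiplicative.ofAdd (congrFun (LinearMap.mem_ker.1 hz) i)
    have hH : ∀ h ∈ H, z.1 h (1 : G) = 0 := fun h hh =>
      congrArg Multiplicative.toAdd (DFunLike.congr_fun hone ⟨h, hh⟩)
    have hcoset : ∀ g k : G, z.1 (g * k) (1 : G) = z.1 g (k : G ⧸ H) + z.1 k (1 : G) := by
      intro g k
      rw [z.2, MulAction.Quotient.smul_coe, smul_eq_mul, mul_one]
    -- As `z` vanishes on `H` at the trivial coset, `z k 1` depends only on `kH`; this is the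
    -- potential.
    refine ⟨fun q => z.1 q.out (1 : G), ?_⟩
    have hout : ∀ g : G, z.1 (g : G ⧸ H).out (1 : G) = z.1 g (1 : G) := by
      intro g
      obtain ⟨h, hh⟩ := QuotientGroup.mk_out_eq_mul H g
      have h1 : ((h : G) : G ⧸ H) = (1 : G) := QuotientGroup.eq.2 (by simp)
      rw [hh, hcoset, hH h h.2, add_zero, h1]
    ext g q
    induction q using QuotientGroup.induction_on with
    | _ k =>
      change z.1 (g • (k : G ⧸ H)).out (1 : G) - z.1 (k : G ⧸ H).out (1 : G) = _
      rw [MulAction.Quotient.smul_coe, hout, hout, smul_eq_mul, hcoset, add_sub_cancel_right]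

end Cocycles

theorem finite_of_module_finite_pi {ι : Type*} [Module.Finite ℚ (ι → ℚ)] : Finite ι := by
  classical
  exact (Pi.linearIndependent_single_one ι ℚ).finite

/-- The Schreier index formula. -/
theorem finite_and_card_basis {A : Type u} [Finite A] (H : Subgroup (FreeGroup A))
    (hH : H.index ≠ 0) {ι : Type*} (b : FreeGroupBasis ι H) :
    Finite ι ∧ (Nat.card ι : ℤ) = 1 + (H.index : ℤ) * ((Nat.card A : ℤ) - 1) := by
  have hfin : Finite (FreeGroup A ⧸ H) := Nat.finite_of_card_ne_zero hH
  have e : cocycles (FreeGroup A) (FreeGroup A ⧸ H) ≃ₗ[ℚ] (A × (FreeGroup A ⧸ H) → ℚ) :=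
    LinearEquiv.ofBijective _ ⟨cocyclesToGenerators_injective _ _,
      cocyclesToGenerators_surjective _ _⟩
  have : Module.Finite ℚ (cocycles (FreeGroup A) (FreeGroup A ⧸ H)) :=
    Module.Finite.equiv e.symm
  -- Finiteness of `ι` must precede the count, since `finrank` is `0` in infinite dimension.
  have := Module.Finite.of_surjective _ (cocyclesToBasis_surjective b)
  have hι : Finite ι := finite_of_module_finite_pi
  have := Fintype.ofFinite A
  have := Fintype.ofFinite (FreeGroup A ⧸ H)
  have := Fintype.ofFinite ι
  refine ⟨hι, ?_⟩
  have h1 := (coboundary (FreeGroup A) (FreeGroup A ⧸ H)).finrank_range_add_finrank_ker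
  have h2 := (cocyclesToBasis b).finrank_range_add_finrank_ker
  rw [finrank_ker_coboundary, range_coboundary_eq_ker b, Module.finrank_fintype_fun_eq_card] at h1
  rw [LinearMap.range_eq_top.2 (cocyclesToBasis_surjective b), finrank_top, e.finrank_eq,
    Module.finrank_fintype_fun_eq_card, Module.finrank_fintype_fun_eq_card, Fintype.card_prod] at h2
  rw [Subgroup.index, Nat.card_eq_fintype_card, Nat.card_eq_fintype_card, Nat.card_eq_fintype_card]
  zify at h1 h2
  linarith

end Stallings

theorem mainTheorem5 {A : Type u} [Finite A] :
    (∀ H : Subgroup (FreeGroup A), H.FG →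
      ∀ (Q : Type u) (S : NFA (A × Bool) Q), Stallings.IsStallingsAutomaton H S →
        (H.FiniteIndex ↔ Stallings.IsComplete S) ∧
        (H.FiniteIndex → Finite Q ∧ H.index = Nat.card Q)) ∧
    (∀ (H : Subgroup (FreeGroup A)) (n : ℕ), n ≠ 0 → H.index = n →
      IsFreeGroup H ∧
      ∀ (ι : Type*), FreeGroupBasis ι H →
        Finite ι ∧ (Nat.card ι : ℤ) = 1 + (n : ℤ) * ((Nat.card A : ℤ) - 1)) := by
  refine ⟨fun H _ Q S hS => ⟨hS.finiteIndex_iff_isComplete, fun hH =>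
    ⟨Stallings.finite_of_isStallingsAutomaton hS, hS.index_eq_card hH⟩⟩, ?_⟩
  rintro H n hn rfl
  -- The instance is the Nielsen–Schreier theorem.
  exact ⟨inferInstance, fun ι b => Stallings.finite_and_card_basis H hn b⟩
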